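/- **Setting.** A problem instance $I$ is a finite directed graph $G$ (its vertices, the states, carry names from a fixed infinite set) with edge costs $c(u,v)\ge 0$, two states $start$ and $goal$, two heuristics $h_F,h_B$ from states to $[0,\infty]$, and two functions: $expand_F$ maps a forward path $U$ to the sequence of all its one-edge forward extensions, and $expand_B$ maps a backward path $V$ (a path along reversed edges) to the sequence of all its one-edge backward extensions. Let $d$ be the distance in $G$, $C^*=d(start,goal)$, and $end(U)$ the last state of $U$. Let $I_{AD}$ be the class of instances with $C^*<\infty$, $h_F(u)\le d(u,goal)$ and $h_B(v)\le d(start,v)$ for all states, and $I_{CON}\subseteq I_{AD}$ the subclass in which moreover $h_F(u)\le d(u,u')+h_F(u')$ and $h_B(v)\le d(v',v)+h_B(v')$ for all states. For a forward path $U$ and a backward path $V$ put $$lb(U,V)=\max\{c(U)+h_F(end(U)),\ c(V)+h_B(end(V)),\ c(U)+c(V)\}.$$ A pair of states $(u,v)$ is *surely expanded* (s.e.) if there are an optimal forward path $U$ from $start$ to $u$ and an optimal backward path $V$ from $goal$ to $v$ with $lb(U,V)<C^*$. A set of expansions *covers* the s.e. pairs if for every such pair $u$ is expanded in the forward direction or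 $v$ in the backward direction. A *DXBB front-to-end bidirectional algorithm* is a deterministic algorithm that in each step either stops with an answer or applies $expand_F$ or $expand_B$ to a path generated before (at first only the empty paths at $start$ and $goal$ are generated), its choice depending only on $start$, $goal$, their heuristic values, and the earlier calls with their replies: the generated states, the costs of the edges through which they were generated, and their heuristic values. It is *admissible* if on every instance of $I_{AD}$ it stops and returns an optimal solution (an optimal path from $start$ to $goal$, or the cost $C^*$). *NBS* keeps lists $Open_F=\{(start)\}$, $Open_B=\{(goal)\}$, $Closed_F=Closed_B=\emptyset$ and a number $C=\infty$ (initial values). While both open lists are nonempty and $lbmin=\min\{lb(X,Y): X\in Open_F, Y\in Open_B\}<C$, it chooses, among the pairs with $lb=lbmin$, a first component $U$ of least cost and then a partner $V$ of $U$ of least cost (ties broken arbitrarily), expands $U$ forward and then $V$ backward. To expand $U$ forward, it moves $U$ to $Closed_F$ and for each $W\in expand_F(U)$: it sets $C\leftarrow\min(C,c(W)+c(Y))$ if some $Y\in Open_B$ has $end(Y)=end(W)$; if some $X\in Open_F\cup Closed_F$ with $end(X)=end(W)$ has $c(X)\le c(W)$ it discards $W$; otherwise it removes any such $X$ from the lists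 and adds $W$ to $Open_F$. Backward expansion is analogous. **Corollary.** Let $I\in I_{CON}$ and let $A$ be any admissible DXBB front-to-end bidirectional algorithm. Then $A$ covers the s.e. pairs of $I$, and so does NBS, however it breaks ties; and the number of state expansions that NBS makes in covering them is at most twice the number of states (counted separately in each direction) that $A$ expands in covering them. Moreover, the worst-case expansion ratio of NBS is at most $2$: $\sup_{I\in I_{CON}}\#NBS(I)/\#(I)\le 2$, where $\#NBS(I)$ is the number of state expansions that NBS makes in covering the s.e. pairs of $I$ and $\#(I)$ is the smallest number of states that any DXBB front-to-end bidirectional algorithm (admissible or not) expands in covering them (with $0/0=0$). -/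

import Mathlib

open scoped NNReal ENNReal

namespace BiSearch

universe u

/-- The two search directions. -/
inductive Dir
  | fwd
  | bwd

/-- The opposite direction. -/
def Dir.other : Dir → Dir
  | .fwd => .bwd
  | .bwd => .fwd

/-- Nonempty finite sequences of states: `single s` is `(s)`, and `snoc U s` is `U` followed by the
one additional state `s`. -/
inductive SPath (S : Type u) : Type u
  | single (s : S) : SPath S
  | snoc (U : SPath S) (s : S) : SPath S

namespace SPath

variable {S : Type u}

/-- The first state `U_0`. -/
def first : SPath S → S
  | single s => s
  | snoc U _ => U.first

/-- The last state `end(U)`. -/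
def last : SPath S → S
  | single s => s
  | snoc _ s => s

/-- Sequences all of whose steps satisfy the relation `E` and that start in the set `X`. -/
def Chain (X : Set S) (E : S → S → Prop) : SPath S → Prop
  | single s => s ∈ X
  | snoc U s => U.Chain X E ∧ E U.last s

/-- The sum of the weights of the steps. -/
def weight (w : S → S → ℝ≥0) : SPath S → ℝ≥0
  | single _ => 0
  | snoc U s => U.weight w + w U.last s

end SPath

/-- A problem instance whose states are named by elements of `S`: a finite directed graph on the
vertex set `states` with nonnegative edge costs, a start, a goal, the two expand functions, and two
front-to-end heuristics.

`succs U` (resp. `preds V`) lists, in the order in which the expand function produces them, the last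
states of the paths in `expand_F(U)` (resp. `expand_B(V)`); the order may depend on the whole path.
Values of `cost` off the edges, of `hF`, `hB` off the states, and of `succs`, `preds` on sequences
which are not paths are irrelevant. -/
structure ProblemInstance (S : Type u) where
  states : Finset S
  Edge : S → S → Prop
  edge_left : ∀ a b, Edge a b → a ∈ states
  edge_right : ∀ a b, Edge a b → b ∈ states
  cost : S → S → ℝ≥0
  start : S
  goal : S
  start_mem : start ∈ states
  goal_mem : goal ∈ states
  succs : SPath S → List S
  succs_nodup : ∀ U, U.Chain (states : Set S) Edge → (succs U).Nodup
  mem_succs : ∀ U, U.Chain (states : Set S) Edge → ∀ s, s ∈ succs U ↔ Edge U.last s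
  preds : SPath S → List S
  preds_nodup : ∀ V, V.Chain (states : Set S) (fun a b => Edge b a) → (preds V).Nodup
  mem_preds : ∀ V, V.Chain (states : Set S) (fun a b => Edge b a) →
    ∀ s, s ∈ preds V ↔ Edge s V.last
  hF : S → ℝ≥0∞
  hB : S → ℝ≥0∞

namespace ProblemInstance

variable {S : Type u} (I : ProblemInstance S)

/-- `start` in the forward direction, `goal` in the backward direction. -/
def root : Dir → S
  | .fwd => I.start
  | .bwd => I.goal

/-- Edges, reversed in the backward direction. -/
def Step : Dir → S → S → Prop
  | .fwd => fun a b => I.Edge a b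
  | .bwd => fun a b => I.Edge b a

/-- The cost of an edge; a reverse edge costs as much as the original edge. -/
def stepCost : Dir → S → S → ℝ≥0
  | .fwd => fun a b => I.cost a b
  | .bwd => fun a b => I.cost b a

/-- The heuristic used in each direction. -/
def h : Dir → S → ℝ≥0∞
  | .fwd => I.hF
  | .bwd => I.hB

/-- The last states of the paths produced by expanding `U` in direction `d`. -/
def nexts : Dir → SPath S → List S
  | .fwd => I.succs
  | .bwd => I.preds

/-- The expand functions `expand_F` and `expand_B`, from paths to sequences of paths. -/
def expand (d : Dir) (U : SPath S) : List (SPath S) :=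
  (I.nexts d U).map fun s => U.snoc s

/-- Forward paths and backward paths. -/
def IsPath (d : Dir) (U : SPath S) : Prop :=
  U.Chain (I.states : Set S) (I.Step d)

/-- The cost `c(U)` of a path. -/
def c (d : Dir) (U : SPath S) : ℝ≥0 :=
  U.weight (I.stepCost d)

/-- `U` is an optimal path in direction `d`: there is no cheaper one with the same endpoints. -/
def IsOptimal (d : Dir) (U : SPath S) : Prop :=
  I.IsPath d U ∧
    ∀ W, I.IsPath d W → W.first = U.first → W.last = U.last → I.c d U ≤ I.c d W

/-- The distance `d(a,b)`, which is `∞` if there is no forward path from `a` to `b`. -/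
noncomputable def dist (a b : S) : ℝ≥0∞ :=
  ⨅ (U : SPath S) (_ : I.IsPath .fwd U ∧ U.first = a ∧ U.last = b), (I.c .fwd U : ℝ≥0∞)

/-- The optimal solution cost `C*`. -/
noncomputable def optCost : ℝ≥0∞ := I.dist I.start I.goal

/-- There is a forward path from the start to the goal. -/
def Solvable : Prop :=
  ∃ U, I.IsPath .fwd U ∧ U.first = I.start ∧ U.last = I.goal

/-- The class `I_AD`: solvable instances with admissible heuristics. -/
def IsAD : Prop :=
  I.Solvable ∧ (∀ a ∈ I.states, I.hF a ≤ I.dist a I.goal) ∧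
    (∀ b ∈ I.states, I.hB b ≤ I.dist I.start b)

/-- The class `I_CON`: instances of `I_AD` with consistent heuristics. -/
def IsCON : Prop :=
  I.IsAD ∧ (∀ a ∈ I.states, ∀ a' ∈ I.states, I.hF a ≤ I.dist a a' + I.hF a') ∧
    (∀ b ∈ I.states, ∀ b' ∈ I.states, I.hB b ≤ I.dist b' b + I.hB b')

/-- `f_F(U)` and `f_B(V)`. -/
noncomputable def f (d : Dir) (U : SPath S) : ℝ≥0∞ := I.c d U + I.h d U.last

/-- `lb(U,V) = max {f_F(U), f_B(V), c(U) + c(V)}`. -/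
noncomputable def lb (U V : SPath S) : ℝ≥0∞ :=
  max (max (I.f .fwd U) (I.f .bwd V)) ((I.c .fwd U : ℝ≥0∞) + I.c .bwd V)

/-- `(a,b)` is a surely expanded state pair, i.e. the left copy of `a` and the right copy of `b` are
adjacent in the must-expand graph. -/
def SurelyExpanded (a b : S) : Prop :=
  ∃ U V, I.IsOptimal .fwd U ∧ U.first = I.start ∧ U.last = a ∧
    I.IsOptimal .bwd V ∧ V.first = I.goal ∧ V.last = b ∧ I.lb U V < I.optCost

end ProblemInstance

/-! ### Expansions and covering -/

/-- A sequence of calls of the expand functions. -/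
abbrev Trace (S : Type u) := List (Dir × SPath S)

/-- The states that are expanded in direction `d` by the calls in `T`. -/
def expandedStates {S : Type u} (T : Trace S) (d : Dir) : Set S :=
  {s | ∃ U, (d, U) ∈ T ∧ U.last = s}

/-- The number `|S_F| + |S_B|` of (distinct) states expanded by the calls in `T`. -/
noncomputable def numExpandedStates {S : Type u} (T : Trace S) : ℕ :=
  (expandedStates T .fwd).ncard + (expandedStates T .bwd).ncard

/-- Every surely expanded pair `(a,b)` has been expanded: `a` in the forward direction or `b` in the
backward direction. -/
def Covers {S : Type u} (I : ProblemInstance S) (T : Trace S) : Prop :=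
  ∀ a b, I.SurelyExpanded a b → a ∈ expandedStates T .fwd ∨ b ∈ expandedStates T .bwd

/-! ### DXBB front-to-end bidirectional algorithms -/

/-- What an algorithm is told about a state when it is generated: the state, the cost of the edge
through which it was generated, and the two heuristic values of the state. -/
structure ChildInfo (S : Type u) where
  state : S
  edgeCost : ℝ≥0
  hF : ℝ≥0∞
  hB : ℝ≥0∞

/-- One call of an expand function, with the reply. -/
structure CallRecord (S : Type u) where
  dir : Dir
  path : SPath S
  children : List (ChildInfo S)

/-- Everything an algorithm knows at some point of its execution: start and goal with their heuristic
values, and the calls made so far with their replies, in chronological order. -/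
structure History (S : Type u) where
  start : S
  goal : S
  hFstart : ℝ≥0∞
  hBstart : ℝ≥0∞
  hFgoal : ℝ≥0∞
  hBgoal : ℝ≥0∞
  calls : List (CallRecord S)

namespace History

variable {S : Type u}

/-- The calls made so far, without the replies. -/
def trace (H : History S) : Trace S := H.calls.map fun r => (r.dir, r.path)

/-- The start in the forward direction, the goal in the backward direction. -/
def root (H : History S) : Dir → S
  | .fwd => H.start
  | .bwd => H.goal

/-- The paths generated so far in direction `d`: the empty path from the root, and every path
returned by an earlier call in direction `d`. -/
def Generated (H : History S) (d : Dir) (U : SPath S) : Prop :=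
  U = .single (H.root d) ∨
    ∃ r ∈ H.calls, r.dir = d ∧ ∃ k ∈ r.children, U = r.path.snoc k.state

end History

/-- What an algorithm may return: a solution path, or only the cost of a solution. -/
inductive Answer (S : Type u) : Type u
  | path (P : SPath S) : Answer S
  | cost (x : ℝ≥0∞) : Answer S

/-- The answer is an optimal solution path of `I`, or the optimal solution cost of `I`. -/
def Answer.IsCorrect {S : Type u} (I : ProblemInstance S) : Answer S → Prop
  | .path P => I.IsOptimal .fwd P ∧ P.first = I.start ∧ P.last = I.goal
  | .cost x => x = I.optCost

/-- The next move of an algorithm: call an expand function, or stop with an answer. -/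
inductive Move (S : Type u) : Type u
  | expand (d : Dir) (U : SPath S) : Move S
  | halt (a : Answer S) : Move S

/-- A DXBB front-to-end bidirectional search algorithm: deterministic, expanding only what has been
generated before, and depending on the instance only through the replies received so far. -/
structure DXBB (S : Type u) where
  move : History S → Move S
  legal : ∀ H d U, move H = .expand d U → H.Generated d U

namespace DXBB

variable {S : Type u}

/-- What is known before the first expansion. -/
def initHistory (I : ProblemInstance S) : History S where
  start := I.start
  goal := I.goal
  hFstart := I.hF I.start
  hBstart := I.hB I.start
  hFgoal := I.hF I.goal
  hBgoal := I.hB I.goal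
  calls := []

/-- The call `expand_F(U)` or `expand_B(U)` on the instance `I`, with the reply. -/
def call (I : ProblemInstance S) (d : Dir) (U : SPath S) : CallRecord S where
  dir := d
  path := U
  children := (I.nexts d U).map fun s => ⟨s, I.stepCost d U.last s, I.hF s, I.hB s⟩

/-- The history of the algorithm on input `I` after `n` moves; it stays put after `halt`. -/
def run (A : DXBB S) (I : ProblemInstance S) : ℕ → History S
  | 0 => initHistory I
  | n + 1 =>
    match A.move (A.run I n) with
    | .expand d U => { A.run I n with calls := (A.run I n).calls ++ [call I d U] }
    | .halt _ => A.run I n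

/-- The algorithm stops on every instance of `I_AD`, with an optimal solution. -/
def Admissible (A : DXBB S) : Prop :=
  ∀ I : ProblemInstance S, I.IsAD → ∃ n a, A.move (A.run I n) = .halt a ∧ a.IsCorrect I

/-- The number of states that the algorithm expands in covering the surely expanded pairs of `I`,
that is, up to the first moment at which all of them have been expanded (`⊤` if this never
happens). -/
noncomputable def coverCount (A : DXBB S) (I : ProblemInstance S) : ℕ∞ :=
  ⨅ (n : ℕ) (_ : Covers I (A.run I n).trace), (numExpandedStates (A.run I n).trace : ℕ∞)

end DXBB

/-- The smallest number of states that any DXBB front-to-end bidirectional search algorithm expands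
in covering the surely expanded pairs of `I`. -/
noncomputable def minCoverCount {S : Type u} (I : ProblemInstance S) : ℕ∞ :=
  ⨅ A : DXBB S, A.coverCount I

/-! ### The algorithm NBS -/

/-- The variables of NBS: the two open lists, the two closed lists and the cost `C` of the best
solution found; `trace` records the calls of the expand functions. -/
structure NBSConfig (S : Type u) where
  opn : Dir → Set (SPath S)
  closed : Dir → Set (SPath S)
  C : ℝ≥0∞
  trace : Trace S

namespace NBSConfig

variable {S : Type u}

/-- The initial values of the variables. -/
def init (I : ProblemInstance S) : NBSConfig S where
  opn := fun d => {.single (I.root d)}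
  closed := fun _ => ∅
  C := ⊤
  trace := []

/-- Move `U` from the open list to the closed list of direction `d`, and record the call. -/
def close (K : NBSConfig S) (d : Dir) (U : SPath S) : NBSConfig S where
  opn := fun e => {X | X ∈ K.opn e ∧ ¬ (e = d ∧ X = U)}
  closed := fun e => {X | X ∈ K.closed e ∨ (e = d ∧ X = U)}
  C := K.C
  trace := K.trace ++ [(d, U)]

/-- `C ← min (C, c(W) + c(Y))` for `Y` open in the other direction with `end(Y) = end(W)`. -/
noncomputable def updateC (I : ProblemInstance S) (d : Dir) (K : NBSConfig S) (W : SPath S) :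
    NBSConfig S :=
  { K with
    C := min K.C (⨅ (Y : SPath S) (_ : Y ∈ K.opn d.other ∧ Y.last = W.last),
      ((I.c d W : ℝ≥0∞) + I.c d.other Y)) }

/-- Some path in the open or closed list of direction `d` leads to `end(W)` at no higher cost. -/
def Dominated (I : ProblemInstance S) (d : Dir) (K : NBSConfig S) (W : SPath S) : Prop :=
  ∃ X, (X ∈ K.opn d ∨ X ∈ K.closed d) ∧ X.last = W.last ∧ I.c d X ≤ I.c d W

/-- Remove the paths to `end(W)` from the lists of direction `d`, and add `W` to the open list. -/
def insertPath (d : Dir) (K : NBSConfig S) (W : SPath S) : NBSConfig S :=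
  { K with
    opn := fun e => {X | (X ∈ K.opn e ∧ ¬ (e = d ∧ X.last = W.last)) ∨ (e = d ∧ X = W)}
    closed := fun e => {X | X ∈ K.closed e ∧ ¬ (e = d ∧ X.last = W.last)} }

open Classical in
/-- The body of the loop over the paths `W` returned by the expand function: update `C`, then
discard `W` if it is dominated, and insert it otherwise. -/
noncomputable def addChild (I : ProblemInstance S) (d : Dir) (K : NBSConfig S) (W : SPath S) :
    NBSConfig S :=
  if Dominated I d K W then updateC I d K W else insertPath d (updateC I d K W) W

/-- Forward-Expand and Backward-Expand. -/
noncomputable def expandPath (I : ProblemInstance S) (d : Dir) (K : NBSConfig S) (U : SPath S) :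
    NBSConfig S :=
  (I.expand d U).foldl (addChild I d) (K.close d U)

/-- The minimum of `lb` over all pairs of open paths. -/
noncomputable def lbmin (I : ProblemInstance S) (K : NBSConfig S) : ℝ≥0∞ :=
  ⨅ (X ∈ K.opn .fwd) (Y ∈ K.opn .bwd), I.lb X Y

/-- NBS stops: an open list is empty, or `lbmin ≥ C`. -/
def Halted (I : ProblemInstance S) (K : NBSConfig S) : Prop :=
  K.opn .fwd = ∅ ∨ K.opn .bwd = ∅ ∨ K.C ≤ K.lbmin I

/-- The pairs of open paths that attain `lbmin`. -/
def minset (I : ProblemInstance S) (K : NBSConfig S) : Set (SPath S × SPath S) :=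
  {p | p.1 ∈ K.opn .fwd ∧ p.2 ∈ K.opn .bwd ∧ I.lb p.1 p.2 = K.lbmin I}

/-- The first components of the pairs in `minset`. -/
def Uset (I : ProblemInstance S) (K : NBSConfig S) : Set (SPath S) :=
  {X | ∃ Y, (X, Y) ∈ K.minset I}

/-- The partners of `U` in `minset`. -/
def Vset (I : ProblemInstance S) (K : NBSConfig S) (U : SPath S) : Set (SPath S) :=
  {Y | (U, Y) ∈ K.minset I}

/-- One iteration of the main loop leads from `K` to `K'`: for a cheapest `U` in `Uset` and then a
cheapest `V` in `Vset`, expand `U` forward and `V` backward. Ties are broken arbitrarily. -/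
def Iterate (I : ProblemInstance S) (K K' : NBSConfig S) : Prop :=
  ¬ K.Halted I ∧ ∃ U V,
    (U ∈ K.Uset I ∧ ∀ X ∈ K.Uset I, I.c .fwd U ≤ I.c .fwd X) ∧
    (V ∈ K.Vset I U ∧ ∀ Y ∈ K.Vset I U, I.c .bwd V ≤ I.c .bwd Y) ∧
    K' = expandPath I .bwd (expandPath I .fwd K U) V

end NBSConfig

/-- `K n` is the configuration of NBS after `n` iterations, for some way of breaking ties; it stays
put once NBS has stopped. -/
def IsNBSRun {S : Type u} (I : ProblemInstance S) (K : ℕ → NBSConfig S) : Prop :=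
  K 0 = NBSConfig.init I ∧
    ∀ n, (K n).Iterate I (K (n + 1)) ∨ ((K n).Halted I ∧ K (n + 1) = K n)

/-- The number of state expansions that the run `K` of NBS makes in covering the surely expanded
pairs of `I`: all calls of the expand functions, repeated ones included, up to the end of the first
iteration after which all these pairs have been expanded (`⊤` if this never happens). -/
noncomputable def nbsCoverCount {S : Type u} (I : ProblemInstance S) (K : ℕ → NBSConfig S) : ℕ∞ :=
  ⨅ (n : ℕ) (_ : Covers I (K n).trace), ((K n).trace.length : ℕ∞)

/-- The worst-case expansion ratio of NBS: the supremum, over all instances of `I_CON` and all runs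
of NBS on them, of the number of expansions of NBS divided by the smallest possible number (with
`0 / 0 = 0` and `x / 0 = ∞` for `x > 0`). -/
noncomputable def nbsWorstCaseRatio (S : Type u) : ℝ≥0∞ :=
  ⨆ (I : ProblemInstance S) (_ : I.IsCON) (K : ℕ → NBSConfig S) (_ : IsNBSRun I K),
    (nbsCoverCount I K : ℝ≥0∞) / (minCoverCount I : ℝ≥0∞)

end BiSearch

open BiSearch

namespace BiSearch

variable {S : Type*} {I : ProblemInstance S}

/-! Two arguments meet in the notion of covering.

Admissible algorithms cover, by an adversary argument. If an algorithm halts on a consistent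
instance having expanded neither `u` forward nor `v` backward for a surely expanded pair `(u, v)`,
add a fresh state `w` and a connection `u → w → v` of total cost `δ`. Since `lb U V < C*`, `δ` can
be large enough to keep the heuristics admissible and yet small enough to make the route through `w`
cheaper than `C*` (`exists_gap`, `hF_detour_le`, `hB_detour_le`). Only the two omitted expansions
would reveal the new edges, so the run and its answer are the same on both instances (`run_detour`),
and the answer is wrong on one of them. The modified instance need only lie in `I_AD`, which is why
admissibility on that whole class is used.

NBS is optimal up to a factor 2, by matching against vertex cover. While some surely expanded pair
is uncovered, an iteration of NBS picks optimal paths `U`, `V` with `lb U V < C*`, whose last states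
are expanded for the first time (`Inv.iterate`). This rests on consistency: `f` does not decrease
along a path, so any path from the root either leads to a closed path to its end at no higher cost,
or has an open path no worse in both `c` and `f` (`Inv.exists_open`). The iterations thus form a
matching of surely expanded pairs. Every covering set of expansions contains an endpoint of each
matched pair, so `n` iterations, which are `2 * n` expansions, force any cover to have at least `n`
states. This comparison needs nothing of the other algorithm except that it covers, so it also
bounds the worst-case ratio. -/

theorem Dir.other_ne (d : Dir) : d.other ≠ d := by cases d <;> simp [Dir.other]

/-! ### Paths, costs and distances. -/

namespace ProblemInstance

theorem isPath_single {d : Dir} {s : S} : I.IsPath d (.single s) ↔ s ∈ I.states := Iff.rfl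

theorem c_single {d : Dir} {s : S} : I.c d (.single s) = 0 := rfl

theorem c_snoc {d : Dir} {U : SPath S} {s : S} :
    I.c d (U.snoc s) = I.c d U + I.stepCost d U.last s := rfl

theorem root_mem (d : Dir) : I.root d ∈ I.states := by
  cases d
  exacts [I.start_mem, I.goal_mem]

theorem Step.left_mem {d : Dir} {a b : S} (h : I.Step d a b) : a ∈ I.states := by
  cases d
  exacts [I.edge_left _ _ h, I.edge_right _ _ h]

theorem Step.right_mem {d : Dir} {a b : S} (h : I.Step d a b) : b ∈ I.states := by
  cases d
  exacts [I.edge_right _ _ h, I.edge_left _ _ h]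

theorem step_other {d : Dir} {a b : S} : I.Step d.other a b ↔ I.Step d b a := by
  cases d <;> rfl

theorem stepCost_other {d : Dir} {a b : S} : I.stepCost d.other a b = I.stepCost d b a := by
  cases d <;> rfl

theorem IsPath.last_mem {d : Dir} {U : SPath S} (h : I.IsPath d U) : U.last ∈ I.states := by
  cases U with
  | single s => exact h
  | snoc U s => exact Step.right_mem h.2

theorem mem_nexts {d : Dir} {U : SPath S} (h : I.IsPath d U) (s : S) :
    s ∈ I.nexts d U ↔ I.Step d U.last s := by
  cases d
  exacts [I.mem_succs U h s, I.mem_preds U h s]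

/-- A path can be continued along the reverse of a path of the opposite direction. -/
theorem exists_join {d : Dir} {Y : SPath S} (hY : I.IsPath d.other Y) :
    ∀ {W : SPath S}, I.IsPath d W → W.last = Y.last →
      ∃ P, I.IsPath d P ∧ P.first = W.first ∧ P.last = Y.first ∧
        I.c d P = I.c d W + I.c d.other Y := by
  induction Y with
  | single s => exact fun {W} hW h => ⟨W, hW, rfl, h, by simp [c_single]⟩
  | snoc Y s ih =>
    intro W hW h
    have hs : I.Step d W.last Y.last := by
      rw [h]; exact step_other.1 hY.2
    obtain ⟨P, hP, h1, h2, h3⟩ := ih hY.1 (W := W.snoc Y.last) ⟨hW, hs⟩ rfl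
    refine ⟨P, hP, h1, h2, ?_⟩
    rw [h3, c_snoc, c_snoc, stepCost_other, h]
    simp only [SPath.last]
    ring

theorem exists_append {d : Dir} {P W : SPath S} (hP : I.IsPath d P) (hW : I.IsPath d W)
    (h : P.last = W.first) :
    ∃ Q, I.IsPath d Q ∧ Q.first = P.first ∧ Q.last = W.last ∧ I.c d Q = I.c d P + I.c d W := by
  induction W with
  | single s => exact ⟨P, hP, rfl, h, by simp [c_single]⟩
  | snoc W s ih =>
    obtain ⟨Q, hQ, h1, h2, h3⟩ := ih hW.1 h
    refine ⟨Q.snoc s, ⟨hQ, by rw [h2]; exact hW.2⟩, h1, rfl, ?_⟩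
    rw [c_snoc, c_snoc, h3, h2, add_assoc]

theorem dist_le {U : SPath S} (h : I.IsPath .fwd U) : I.dist U.first U.last ≤ I.c .fwd U :=
  iInf₂_le U ⟨h, rfl, rfl⟩

theorem dist_self {a : S} (h : a ∈ I.states) : I.dist a a = 0 :=
  le_antisymm (by simpa [c_single, SPath.first, SPath.last] using dist_le (U := .single a) (isPath_single.2 h)) bot_le

theorem dist_le_cost {a b : S} (h : I.Edge a b) : I.dist a b ≤ I.cost a b := by
  simpa [c_single, c_snoc, stepCost, SPath.first, SPath.last] using
    dist_le (U := (SPath.single a).snoc b) ⟨I.edge_left _ _ h, h⟩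

theorem dist_triangle (a b c : S) : I.dist a c ≤ I.dist a b + I.dist b c := by
  simp only [dist, ENNReal.iInf_add, ENNReal.add_iInf]
  refine le_iInf₂ fun W hW => le_iInf₂ fun P hP => ?_
  obtain ⟨Q, hQ, h1, h2, h3⟩ := exists_append hP.1 hW.1 (hP.2.2.trans hW.2.1.symm)
  refine iInf₂_le_of_le Q ⟨hQ, h1.trans hP.2.1, h2.trans hW.2.2⟩ ?_
  rw [h3, ENNReal.coe_add, add_comm]

/-- Telescoping the edge inequality along a path. With `ψ b = 0` this makes `ψ` a lower bound for
the distance to `b`, so distances in a modified graph can be estimated without analysing its paths.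
-/
theorem le_dist_add {ψ : S → ℝ≥0∞} (hψ : ∀ a b, I.Edge a b → ψ a ≤ I.cost a b + ψ b) (a b : S) :
    ψ a ≤ I.dist a b + ψ b := by
  have key : ∀ W, I.IsPath .fwd W → ψ W.first ≤ I.c .fwd W + ψ W.last := by
    intro W hW
    induction W with
    | single s => simp [SPath.first, SPath.last, c_single]
    | snoc W s ih =>
      refine (ih hW.1).trans ?_
      rw [c_snoc, ENNReal.coe_add, add_assoc]
      exact add_le_add le_rfl (hψ _ _ hW.2)
  simp only [dist, ENNReal.iInf_add]
  refine le_iInf₂ ?_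
  rintro W ⟨hW, rfl, rfl⟩
  exact key W hW

theorem le_dist_add' {ψ : S → ℝ≥0∞} (hψ : ∀ a b, I.Edge a b → ψ b ≤ I.cost a b + ψ a) (a b : S) :
    ψ b ≤ I.dist a b + ψ a := by
  have key : ∀ W, I.IsPath .fwd W → ψ W.last ≤ I.c .fwd W + ψ W.first := by
    intro W hW
    induction W with
    | single s => simp [SPath.first, SPath.last, c_single]
    | snoc W s ih =>
      refine (hψ _ _ hW.2).trans ?_
      rw [c_snoc, ENNReal.coe_add, add_comm (I.c .fwd W : ℝ≥0∞), add_assoc]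
      exact add_le_add le_rfl (ih hW.1)
  simp only [dist, ENNReal.iInf_add]
  refine le_iInf₂ ?_
  rintro W ⟨hW, rfl, rfl⟩
  exact key W hW

theorem optCost_le_of_fwd_bwd {W Y : SPath S} (hW : I.IsPath .fwd W) (hY : I.IsPath .bwd Y)
    (hWf : W.first = I.start) (hYf : Y.first = I.goal) (h : W.last = Y.last) :
    I.optCost ≤ (I.c .fwd W : ℝ≥0∞) + I.c .bwd Y := by
  obtain ⟨P, hP, h1, h2, h3⟩ := exists_join (d := .fwd) hY hW h
  have := dist_le hP
  rw [h1, h2, h3, hWf, hYf, ENNReal.coe_add] at this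
  exact this

theorem optCost_le {d : Dir} {W Y : SPath S} (hW : I.IsPath d W) (hY : I.IsPath d.other Y)
    (hWf : W.first = I.root d) (hYf : Y.first = I.root d.other) (h : W.last = Y.last) :
    I.optCost ≤ (I.c d W : ℝ≥0∞) + I.c d.other Y := by
  cases d
  · exact optCost_le_of_fwd_bwd hW hY hWf hYf h
  · rw [add_comm]; exact optCost_le_of_fwd_bwd hY hW hYf hWf h.symm

/-- An optimal backward path is as short as the distance in the graph. -/
theorem IsOptimal.le_dist {V : SPath S} (hV : I.IsOptimal .bwd V) :
    (I.c .bwd V : ℝ≥0∞) ≤ I.dist V.last V.first := by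
  refine le_iInf₂ ?_
  rintro P ⟨hP, h1, h2⟩
  have hmem : V.first ∈ I.states := h2 ▸ hP.last_mem
  obtain ⟨Q, hQ, hQ1, hQ2, hQ3⟩ := exists_join (d := .bwd) (Y := P) hP
    (W := .single V.first) hmem h2.symm
  rw [c_single, zero_add] at hQ3
  have := hV.2 Q hQ hQ1 (hQ2.trans h1)
  rw [hQ3] at this
  exact_mod_cast this

theorem IsOptimal.le_dist_fwd {U : SPath S} (hU : I.IsOptimal .fwd U) :
    (I.c .fwd U : ℝ≥0∞) ≤ I.dist U.first U.last := by
  refine le_iInf₂ ?_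
  rintro P ⟨hP, h1, h2⟩
  exact_mod_cast hU.2 P hP h1 h2

theorem IsCON.h_le {d : Dir} {a b : S} (hI : I.IsCON) (hs : I.Step d a b) :
    I.h d a ≤ I.stepCost d a b + I.h d b := by
  have ha := Step.left_mem hs
  have hb := Step.right_mem hs
  cases d
  · exact (hI.2.1 a ha b hb).trans (add_le_add (dist_le_cost hs) le_rfl)
  · exact (hI.2.2 a ha b hb).trans (add_le_add (dist_le_cost hs) le_rfl)

theorem IsCON.f_le_f_snoc {d : Dir} {U : SPath S} {s : S} (hI : I.IsCON)
    (hs : I.Step d U.last s) : I.f d U ≤ I.f d (U.snoc s) := by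
  rw [f, f, c_snoc, ENNReal.coe_add, add_assoc]
  exact add_le_add le_rfl (hI.h_le hs)

theorem Solvable.optCost_ne_top (h : I.Solvable) : I.optCost ≠ ⊤ := by
  obtain ⟨U, hU, h1, h2⟩ := h
  have := dist_le hU
  rw [h1, h2] at this
  exact ne_top_of_le_ne_top ENNReal.coe_ne_top this

end ProblemInstance

namespace ProblemInstance

theorem IsOptimal.eq_optCost {P : SPath S} (h : I.IsOptimal .fwd P) (hf : P.first = I.start)
    (hl : P.last = I.goal) : (I.c .fwd P : ℝ≥0∞) = I.optCost := by
  refine le_antisymm ?_ ?_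
  · rw [optCost, ← hf, ← hl]; exact h.le_dist_fwd
  · rw [optCost, ← hf, ← hl]; exact dist_le h.1

/-! ### Adding a cheap detour to an instance. -/

section Detour

variable {u w v : S}

open Classical in
/-- The instance `I` with a new state `w` and a new connection from `u` through `w` to `v`, of cost
`δ`. -/
noncomputable def detour (I : ProblemInstance S) (u w v : S) (hu : u ∈ I.states)
    (hv : v ∈ I.states) (δ : ℝ≥0) : ProblemInstance S where
  states := insert w I.states
  Edge a b := I.Edge a b ∨ (a = u ∧ b = w) ∨ (a = w ∧ b = v)
  edge_left := by
    rintro a b (h | ⟨rfl, rfl⟩ | ⟨rfl, rfl⟩)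
    · exact Finset.mem_insert_of_mem (I.edge_left _ _ h)
    · exact Finset.mem_insert_of_mem hu
    · exact Finset.mem_insert_self _ _
  edge_right := by
    rintro a b (h | ⟨rfl, rfl⟩ | ⟨rfl, rfl⟩)
    · exact Finset.mem_insert_of_mem (I.edge_right _ _ h)
    · exact Finset.mem_insert_self _ _
    · exact Finset.mem_insert_of_mem hv
  cost a b := if b = w then δ else if a = w then 0 else I.cost a b
  start := I.start
  goal := I.goal
  start_mem := Finset.mem_insert_of_mem I.start_mem
  goal_mem := Finset.mem_insert_of_mem I.goal_mem
  -- Away from `u` and `w` the original list is kept, order included, so that replies agree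
  -- literally and not merely up to permutation.
  succs U := if I.IsPath .fwd U ∧ U.last ≠ u ∧ U.last ≠ w then I.succs U else
    ((insert w I.states).filter fun s =>
      I.Edge U.last s ∨ (U.last = u ∧ s = w) ∨ (U.last = w ∧ s = v)).toList
  succs_nodup U _ := by
    split_ifs with h
    exacts [I.succs_nodup U h.1, Finset.nodup_toList _]
  mem_succs U _ s := by
    split_ifs with h
    · rw [I.mem_succs U h.1]
      simp [h.2.1, h.2.2]
    · simp only [Finset.mem_toList, Finset.mem_filter, Finset.mem_insert, and_iff_right_iff_imp]
      rintro (h | ⟨-, rfl⟩ | ⟨-, rfl⟩)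
      exacts [Or.inr (I.edge_right _ _ h), Or.inl rfl, Or.inr hv]
  preds V := if I.IsPath .bwd V ∧ V.last ≠ v ∧ V.last ≠ w then I.preds V else
    ((insert w I.states).filter fun s =>
      I.Edge s V.last ∨ (s = u ∧ V.last = w) ∨ (s = w ∧ V.last = v)).toList
  preds_nodup V _ := by
    split_ifs with h
    exacts [I.preds_nodup V h.1, Finset.nodup_toList _]
  mem_preds V _ s := by
    split_ifs with h
    · rw [I.mem_preds V h.1]
      simp [h.2.1, h.2.2]
    · simp only [Finset.mem_toList, Finset.mem_filter, Finset.mem_insert, and_iff_right_iff_imp]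
      rintro (h | ⟨rfl, -⟩ | ⟨rfl, -⟩)
      exacts [Or.inr (I.edge_left _ _ h), Or.inr hu, Or.inl rfl]
  hF s := if s = w then 0 else I.hF s
  hB s := if s = w then 0 else I.hB s

variable {hu : u ∈ I.states} {hv : v ∈ I.states} {δ : ℝ≥0}

theorem ne_of_mem_states (hw : w ∉ I.states) {s : S} (hs : s ∈ I.states) : s ≠ w :=
  fun h => hw (h ▸ hs)

theorem mem_states_detour {s : S} :
    s ∈ (I.detour u w v hu hv δ).states ↔ s = w ∨ s ∈ I.states := by
  simp [detour]

theorem detour_cost (hw : w ∉ I.states) {a b : S} (ha : a ∈ I.states) (hb : b ∈ I.states) :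
    (I.detour u w v hu hv δ).cost a b = I.cost a b := by
  simp [detour, ne_of_mem_states hw ha, ne_of_mem_states hw hb]

theorem detour_stepCost (hw : w ∉ I.states) {d : Dir} {a b : S} (ha : a ∈ I.states)
    (hb : b ∈ I.states) : (I.detour u w v hu hv δ).stepCost d a b = I.stepCost d a b := by
  cases d
  exacts [detour_cost hw ha hb, detour_cost hw hb ha]

theorem IsPath.detour {d : Dir} {X : SPath S} (h : I.IsPath d X) :
    (I.detour u w v hu hv δ).IsPath d X := by
  induction X with
  | single s => exact mem_states_detour.2 (Or.inr h)
  | snoc X s ih =>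
    refine ⟨ih h.1, ?_⟩
    cases d
    exacts [Or.inl h.2, Or.inl h.2]

theorem IsPath.c_detour (hw : w ∉ I.states) {d : Dir} {X : SPath S} (h : I.IsPath d X) :
    (I.detour u w v hu hv δ).c d X = I.c d X := by
  induction X with
  | single s => rfl
  | snoc X s ih =>
    rw [c_snoc, c_snoc, ih h.1, detour_stepCost hw (IsPath.last_mem (d := d) h.1) (Step.right_mem h.2)]

/-- Only expansions of `u` forward or `v` backward reveal the detour. -/
theorem call_detour (hw : w ∉ I.states) {d : Dir} {X : SPath S} (h : I.IsPath d X)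
    (hX : X.last ≠ match d with | .fwd => u | .bwd => v) :
    DXBB.call (I.detour u w v hu hv δ) d X = DXBB.call I d X := by
  have hXw := ne_of_mem_states hw h.last_mem
  have hn : (I.detour u w v hu hv δ).nexts d X = I.nexts d X := by
    cases d
    · exact if_pos ⟨h, hX, hXw⟩
    · exact if_pos ⟨h, hX, hXw⟩
  unfold DXBB.call
  rw [hn]
  congr 1
  refine List.map_congr_left fun s hs => ?_
  have hs' := Step.right_mem ((mem_nexts h s).1 hs)
  rw [detour_stepCost hw h.last_mem hs']
  simp [ProblemInstance.detour, ne_of_mem_states hw hs']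

/-- The witness follows `U`, then the detour, then `V` against its direction. -/
theorem optCost_detour_le (hw : w ∉ I.states) {U V : SPath S} (hU : I.IsPath .fwd U)
    (hV : I.IsPath .bwd V) (hUf : U.first = I.start) (hVf : V.first = I.goal)
    (hUl : U.last = u) (hVl : V.last = v) :
    (I.detour u w v hu hv δ).Solvable ∧ (I.detour u w v hu hv δ).optCost ≤
      (I.c .fwd U : ℝ≥0∞) + δ + I.c .bwd V := by
  have hU' : (I.detour u w v hu hv δ).IsPath .fwd ((U.snoc w).snoc v) :=
    ⟨⟨hU.detour, Or.inr (Or.inl ⟨hUl, rfl⟩)⟩, Or.inr (Or.inr ⟨rfl, rfl⟩)⟩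
  have hc : (I.detour u w v hu hv δ).c .fwd ((U.snoc w).snoc v) = I.c .fwd U + δ := by
    rw [c_snoc, c_snoc, hU.c_detour hw]
    simp [stepCost, ProblemInstance.detour, SPath.last, ne_of_mem_states hw hv]
  obtain ⟨P, hP, hPf, hPl, -⟩ := exists_join (d := .fwd) (Y := V) hV.detour hU' hVl.symm
  refine ⟨⟨P, hP, hPf.trans hUf, hPl.trans hVf⟩, ?_⟩
  have := optCost_le_of_fwd_bwd hU' hV.detour hUf hVf hVl.symm
  rwa [hc, hV.c_detour hw, ENNReal.coe_add] at this

theorem hF_detour_le (hw : w ∉ I.states) (hI : I.IsCON) (h : I.hF u ≤ δ + I.dist v I.goal)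
    (a : S) (ha : a ∈ (I.detour u w v hu hv δ).states) :
    (I.detour u w v hu hv δ).hF a ≤ (I.detour u w v hu hv δ).dist a I.goal := by
  classical
  set D := I.detour u w v hu hv δ with hD
  -- The expected distance to the goal in the new graph: the old one, or the one that first goes to
  -- `u` and takes the detour. Only its validity as a lower bound is needed.
  let ψ : S → ℝ≥0∞ := fun a => if a = w then I.dist v I.goal else
    min (I.dist a I.goal) (I.dist a u + (δ + I.dist v I.goal))
  have hψ : ∀ a b, D.Edge a b → ψ a ≤ D.cost a b + ψ b := by
    rintro a b (hab | ⟨rfl, rfl⟩ | ⟨rfl, rfl⟩)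
    · have ha := I.edge_left _ _ hab
      have hb := I.edge_right _ _ hab
      rw [hD, detour_cost hw ha hb]
      simp only [ψ, ne_of_mem_states hw ha, ne_of_mem_states hw hb, if_false]
      rw [← min_add_add_left]
      have hd := dist_le_cost hab
      refine min_le_min ((dist_triangle a b _).trans (add_le_add hd le_rfl)) ?_
      rw [← add_assoc (I.cost a b : ℝ≥0∞)]
      exact add_le_add ((dist_triangle a b _).trans (add_le_add hd le_rfl)) le_rfl
    · simp [ψ, hD, detour, ne_of_mem_states hw hu, dist_self hu]
    · simp only [ψ, hD, detour, ne_of_mem_states hw hv, if_true, if_false, ENNReal.coe_zero,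
        zero_add]
      exact le_min le_rfl (le_add_self.trans le_add_self)
  have key := le_dist_add hψ a I.goal
  have hgoal : ψ I.goal = 0 := by
    simp [ψ, ne_of_mem_states hw I.goal_mem, dist_self I.goal_mem]
  rw [hgoal, add_zero] at key
  rcases mem_states_detour.1 ha with rfl | ha
  · simp [hD, detour]
  · refine le_trans ?_ key
    simp only [ψ, hD, detour, ne_of_mem_states hw ha, if_false]
    -- Admissibility handles routes that avoid the detour; consistency reduces the others to the
    -- bound at `u`.
    exact le_min (hI.1.2.1 a ha) ((hI.2.1 a ha u hu).trans (add_le_add le_rfl h))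

theorem hB_detour_le (hw : w ∉ I.states) (hI : I.IsCON) (h : I.hB v ≤ δ + I.dist I.start u)
    (b : S) (hb : b ∈ (I.detour u w v hu hv δ).states) :
    (I.detour u w v hu hv δ).hB b ≤ (I.detour u w v hu hv δ).dist I.start b := by
  classical
  set D := I.detour u w v hu hv δ with hD
  let ψ : S → ℝ≥0∞ := fun b => if b = w then δ + I.dist I.start u else
    min (I.dist I.start b) (I.dist v b + (δ + I.dist I.start u))
  have hψ : ∀ a b, D.Edge a b → ψ b ≤ D.cost a b + ψ a := by
    rintro a b (hab | ⟨rfl, rfl⟩ | ⟨rfl, rfl⟩)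
    · have ha := I.edge_left _ _ hab
      have hb := I.edge_right _ _ hab
      rw [hD, detour_cost hw ha hb]
      simp only [ψ, ne_of_mem_states hw ha, ne_of_mem_states hw hb, if_false]
      rw [← min_add_add_left]
      have hd := dist_le_cost hab
      refine min_le_min ?_ ?_
      · rw [add_comm]
        exact (dist_triangle _ a b).trans (add_le_add le_rfl hd)
      · rw [← add_assoc (I.cost a b : ℝ≥0∞), add_comm (I.cost a b : ℝ≥0∞)]
        exact add_le_add ((dist_triangle _ a b).trans (add_le_add le_rfl hd)) le_rfl
    · simp only [ψ, hD, detour, ne_of_mem_states hw hu, if_true, if_false]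
      rw [← min_add_add_left]
      exact le_min le_rfl (add_le_add le_rfl (le_add_self.trans le_add_self))
    · simp [ψ, hD, detour, ne_of_mem_states hw hv, dist_self hv]
  have key := le_dist_add' hψ I.start b
  have hstart : ψ I.start = 0 := by
    simp [ψ, ne_of_mem_states hw I.start_mem, dist_self I.start_mem]
  rw [hstart, add_zero] at key
  rcases mem_states_detour.1 hb with rfl | hb
  · simp [hD, detour]
  · refine le_trans ?_ key
    simp only [ψ, hD, detour, ne_of_mem_states hw hb, if_false]
    refine le_min (hI.1.2.2 b hb) ((hI.2.2 b hb v hv).trans (add_le_add le_rfl h))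

end Detour

end ProblemInstance

open ProblemInstance

/-! ### Runs of an algorithm, on an instance and on its detour. -/

namespace DXBB

theorem run_mono {A : DXBB S} {m n : ℕ} (h : m ≤ n) :
    (A.run I m).calls ⊆ (A.run I n).calls := by
  induction n, h using Nat.le_induction with
  | base => exact List.Subset.refl _
  | succ n hmn ih =>
    intro r hr
    simp only [run]
    split
    · exact List.mem_append_left _ (ih hr)
    · exact ih hr

theorem run_root (A : DXBB S) (n : ℕ) (d : Dir) : (A.run I n).root d = I.root d := by
  induction n with
  | zero => cases d <;> rfl
  | succ n ih =>
    rw [← ih]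
    simp only [run]
    split <;> cases d <;> rfl

/-- All calls are made on paths of the instance. -/
theorem isPath_of_mem_calls (A : DXBB S) (n : ℕ) :
    ∀ r ∈ (A.run I n).calls, I.IsPath r.dir r.path ∧ r = call I r.dir r.path := by
  induction n with
  | zero => simp [run, initHistory]
  | succ n ih =>
    intro r hr
    simp only [run] at hr
    split at hr
    · rename_i d U hm
      rcases List.mem_append.1 hr with hr | hr
      · exact ih r hr
      · obtain rfl := List.mem_singleton.1 hr
        refine ⟨?_, rfl⟩
        rcases A.legal _ _ _ hm with hU | ⟨r', hr', rfl, k, hk, hU⟩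
        · rw [run_root] at hU
          subst hU
          exact root_mem d
        · obtain ⟨hp, hc⟩ := ih r' hr'
          rw [hc] at hk
          obtain ⟨s, hs, rfl⟩ := List.mem_map.1 hk
          simp only [call] at hU ⊢
          rw [hU]
          exact ⟨hp, (mem_nexts hp s).1 hs⟩
    · exact ih r hr

theorem run_eq_of_halt {A : DXBB S} {m n : ℕ} {a : Answer S} (h : A.move (A.run I m) = .halt a)
    (hmn : m ≤ n) : A.run I n = A.run I m := by
  induction n, hmn using Nat.le_induction with
  | base => rfl
  | succ n hmn ih =>
    simp only [run, ih, h]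

theorem answer_unique {A : DXBB S} {m n : ℕ} {a b : Answer S}
    (ha : A.move (A.run I m) = .halt a) (hb : A.move (A.run I n) = .halt b) : a = b := by
  rcases le_total m n with h | h
  · rw [run_eq_of_halt ha h, ha] at hb
    exact Move.halt.inj hb
  · rw [run_eq_of_halt hb h, hb] at ha
    exact (Move.halt.inj ha).symm

/-- Equal histories give equal moves, and `call_detour` gives equal replies. The hypotheses on the
trace after `n` moves pass to all earlier moves because calls only accumulate. -/
theorem run_detour (A : DXBB S) {u w v : S} {hu : u ∈ I.states} {hv : v ∈ I.states} {δ : ℝ≥0}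
    (hw : w ∉ I.states) (n : ℕ) (h1 : u ∉ expandedStates (A.run I n).trace .fwd)
    (h2 : v ∉ expandedStates (A.run I n).trace .bwd) :
    A.run (I.detour u w v hu hv δ) n = A.run I n := by
  have key : ∀ m ≤ n, A.run (I.detour u w v hu hv δ) m = A.run I m := by
    intro m
    induction m with
    | zero =>
      intro _
      simp [run, initHistory, detour, ne_of_mem_states hw I.start_mem,
        ne_of_mem_states hw I.goal_mem]
    | succ m ih =>
      intro hm
      have ih := ih (by omega)
      have hmem := run_mono (A := A) (I := I) hm
      have hpath := A.isPath_of_mem_calls (I := I) (m + 1)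
      simp only [run, ih] at hmem hpath ⊢
      cases hmv : A.move (A.run I m) with
      | halt a => rfl
      | expand d U =>
        simp only [hmv] at hmem hpath ⊢
        have hr : call I d U ∈ (A.run I n).calls := hmem (by simp)
        have htr : (d, U) ∈ (A.run I n).trace := List.mem_map.2 ⟨_, hr, rfl⟩
        have hU : I.IsPath d U := (hpath (call I d U) (by simp)).1
        rw [call_detour hw hU]
        cases d
        · rintro (h : U.last = u)
          exact h1 ⟨U, htr, h⟩
        · rintro (h : U.last = v)
          exact h2 ⟨U, htr, h⟩
  exact key n le_rfl

end DXBB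

/-! ### Admissible algorithms cover. -/

/-- The gap `δ` is chosen so that `p + q + δ` is the largest of `p + q`, `p + a`, `q + b`, that is,
the value `lb` of the pair. -/
theorem exists_gap {p q a b r : ℝ≥0} (h1 : p + a < r) (h2 : q + b < r) (h3 : p + q < r) :
    ∃ δ, a ≤ δ + q ∧ b ≤ δ + p ∧ p + δ + q < r := by
  obtain ⟨δ, hδ⟩ := exists_add_of_le
    (le_max_left (p + q) (max (p + a) (q + b)))
  have ha : p + a ≤ max (p + q) (max (p + a) (q + b)) :=
    (le_max_left _ _).trans (le_max_right _ _)
  have hb : q + b ≤ max (p + q) (max (p + a) (q + b)) :=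
    (le_max_right _ _).trans (le_max_right _ _)
  have hr : max (p + q) (max (p + a) (q + b)) < r := max_lt h3 (max_lt h1 h2)
  rw [hδ] at ha hb hr
  refine ⟨δ, ?_, ?_, ?_⟩
  · rw [add_assoc, add_comm q δ] at ha
    exact le_of_add_le_add_left ha
  · rw [add_comm p q, add_assoc, add_comm p δ] at hb
    exact le_of_add_le_add_left hb
  · rwa [add_right_comm]

/-- An admissible algorithm covers the surely expanded pairs of consistent instances. -/
theorem DXBB.Admissible.exists_covers [Infinite S] {A : DXBB S} (hA : A.Admissible)
    (hI : I.IsCON) : ∃ n, Covers I (A.run I n).trace := by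
  obtain ⟨n, ans, hhalt, hans⟩ := hA I hI.1
  refine ⟨n, fun u v huv => ?_⟩
  by_contra hcov
  obtain ⟨hu', hv'⟩ := not_or.1 hcov
  obtain ⟨U, V, hU, hUf, hUl, hV, hVf, hVl, hlb⟩ := huv
  have hu : u ∈ I.states := hUl ▸ hU.1.last_mem
  have hv : v ∈ I.states := hVl ▸ hV.1.last_mem
  obtain ⟨w, hw⟩ := Infinite.exists_notMem_finset I.states
  obtain ⟨r, hr⟩ : ∃ r : ℝ≥0, (r : ℝ≥0∞) = I.optCost :=
    ⟨_, ENNReal.coe_toNNReal hI.1.1.optCost_ne_top⟩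
  obtain ⟨⟨hlF, hlB⟩, hlc⟩ : (I.f .fwd U < r ∧ I.f .bwd V < r) ∧
      (I.c .fwd U : ℝ≥0∞) + I.c .bwd V < r := by
    rw [hr]; simpa [lb, max_lt_iff] using hlb
  simp only [f, hUl, hVl, h] at hlF hlB
  obtain ⟨x, hx⟩ : ∃ x : ℝ≥0, (x : ℝ≥0∞) = I.hF u :=
    ⟨_, ENNReal.coe_toNNReal (ne_top_of_le_ne_top hlF.ne_top le_add_self)⟩
  obtain ⟨y, hy⟩ : ∃ y : ℝ≥0, (y : ℝ≥0∞) = I.hB v :=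
    ⟨_, ENNReal.coe_toNNReal (ne_top_of_le_ne_top hlB.ne_top le_add_self)⟩
  rw [← hx] at hlF
  rw [← hy] at hlB
  obtain ⟨δ, hδ1, hδ2, hδ3⟩ := exists_gap (p := I.c .fwd U) (q := I.c .bwd V) (a := x) (b := y)
    (r := r) (by exact_mod_cast hlF) (by exact_mod_cast hlB) (by exact_mod_cast hlc)
  obtain ⟨hsolv, hopt⟩ := optCost_detour_le (hu := hu) (hv := hv) (δ := δ) hw hU.1 hV.1 hUf hVf
    hUl hVl
  have hdist1 := hV.le_dist
  have hdist2 := hU.le_dist_fwd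
  rw [hVl, hVf] at hdist1
  rw [hUl, hUf] at hdist2
  have hF : I.hF u ≤ δ + I.dist v I.goal := by
    rw [← hx]
    exact le_trans (by exact_mod_cast hδ1) (add_le_add le_rfl hdist1)
  have hB : I.hB v ≤ δ + I.dist I.start u := by
    rw [← hy]
    exact le_trans (by exact_mod_cast hδ2) (add_le_add le_rfl hdist2)
  obtain ⟨m, ans', hhalt', hans'⟩ := hA (I.detour u w v hu hv δ)
    ⟨hsolv, hF_detour_le hw hI hF, hB_detour_le hw hI hB⟩
  have hhalt'' : A.move (A.run (I.detour u w v hu hv δ) n) = .halt ans := by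
    rw [A.run_detour hw n hu' hv', hhalt]
  obtain rfl := DXBB.answer_unique hhalt' hhalt''
  have hlt : (I.detour u w v hu hv δ).optCost < I.optCost := by
    rw [← hr]
    refine hopt.trans_lt ?_
    exact_mod_cast hδ3
  -- A cost cannot equal both optima. A path optimal in both instances would have the same cost in
  -- both, as a path of `I` keeps its cost in the detour.
  cases ans' with
  | cost x => exact hlt.ne (hans'.symm.trans hans)
  | path P =>
    obtain ⟨h1, h2, h3⟩ := hans
    obtain ⟨h1', h2', h3'⟩ := hans'
    refine hlt.ne ?_
    rw [← h1.eq_optCost h2 h3, ← h1'.eq_optCost h2' h3', h1.1.c_detour hw]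

/-! ### The invariant of NBS and the effect of one iteration. -/

namespace NBSConfig

/-- The invariant of NBS up to the moment when all surely expanded pairs are covered, during the
processing of an expansion in direction `d` where the paths in `L` still have to be treated. -/
structure Inv (I : ProblemInstance S) (d : Dir) (L : List (SPath S)) (K : NBSConfig S) : Prop where
  isPath : ∀ e X, (X ∈ K.opn e ∨ X ∈ K.closed e) → I.IsPath e X ∧ X.first = I.root e
  unique : ∀ e X Y, (X ∈ K.opn e ∨ X ∈ K.closed e) → (Y ∈ K.opn e ∨ Y ∈ K.closed e) →
    X.last = Y.last → X = Y
  disjoint : ∀ e X, X ∈ K.opn e → X ∉ K.closed e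
  mem_trace : ∀ e X, X ∈ K.closed e → (e, X) ∈ K.trace
  of_mem_trace : ∀ e X, (e, X) ∈ K.trace → X ∈ K.closed e ∧ I.IsOptimal e X
  root : ∀ e, ∃ X, (X ∈ K.opn e ∨ X ∈ K.closed e) ∧ X.last = I.root e ∧ I.c e X ≤ 0
  step : ∀ e X, X ∈ K.closed e → ∀ s, I.Step e X.last s → (e = d ∧ X.snoc s ∈ L) ∨
    ∃ Y, (Y ∈ K.opn e ∨ Y ∈ K.closed e) ∧ Y.last = s ∧ I.c e Y ≤ I.c e (X.snoc s)
  optCost_le : I.optCost ≤ K.C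

variable {K : NBSConfig S} {d e : Dir} {L : List (SPath S)}

theorem inv_init : (init I).Inv I d [] where
  isPath := by
    rintro e X (rfl | h)
    · exact ⟨isPath_single.2 (root_mem e), rfl⟩
    · exact h.elim
  unique := by
    rintro e X Y (rfl | h) (rfl | h') _
    · rfl
    · exact h'.elim
    · exact h.elim
    · exact h.elim
  disjoint := fun e X _ h => h
  mem_trace := fun e X h => h.elim
  of_mem_trace := fun e X h => by simp [init] at h
  root := fun e => ⟨.single (I.root e), Or.inl rfl, rfl, le_rfl⟩
  step := fun e X h => h.elim
  optCost_le := le_top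

/-- Once no children are pending, the direction in the invariant carries no information. -/
theorem Inv.change_dir (h : K.Inv I d []) (e : Dir) : K.Inv I e [] :=
  { h with step := fun e X hX s hs => Or.inr ((h.step e X hX s hs).resolve_left (by simp)) }

theorem Inv.close {U : SPath S} (h : K.Inv I d []) (hU : U ∈ K.opn d) (hopt : I.IsOptimal d U) :
    (K.close d U).Inv I d (I.expand d U) := by
  have hmem : ∀ e X, (X ∈ (K.close d U).opn e ∨ X ∈ (K.close d U).closed e) ↔
      (X ∈ K.opn e ∨ X ∈ K.closed e) := by
    intro e X
    simp only [NBSConfig.close, Set.mem_ofPred_eq]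
    constructor
    · rintro (h | h | ⟨rfl, rfl⟩)
      exacts [Or.inl h.1, Or.inr h, Or.inl hU]
    · by_cases hc : e = d ∧ X = U
      · exact fun _ => Or.inr (Or.inr hc)
      · rintro (h | h)
        exacts [Or.inl ⟨h, hc⟩, Or.inr (Or.inl h)]
  constructor
  · exact fun e X hX => h.isPath e X ((hmem e X).1 hX)
  · exact fun e X Y hX hY => h.unique e X Y ((hmem e X).1 hX) ((hmem e Y).1 hY)
  · rintro e X ⟨h1, h2⟩ (h3 | h3)
    exacts [h.disjoint e X h1 h3, h2 h3]
  · rintro e X (h1 | ⟨rfl, rfl⟩)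
    · exact List.mem_append_left _ (h.mem_trace e X h1)
    · exact List.mem_append_right _ (by simp)
  · intro e X hX
    rcases List.mem_append.1 hX with hX | hX
    · exact ⟨Or.inl (h.of_mem_trace e X hX).1, (h.of_mem_trace e X hX).2⟩
    · obtain ⟨rfl, rfl⟩ : e = d ∧ X = U := by simpa using hX
      exact ⟨Or.inr ⟨rfl, rfl⟩, hopt⟩
  · intro e
    simp only [hmem]
    exact h.root e
  · rintro e X (h1 | ⟨rfl, rfl⟩) s hs
    · right
      simp only [hmem]
      exact (h.step e X h1 s hs).resolve_left (by simp)
    · left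
      exact ⟨rfl, List.mem_map.2 ⟨s, (mem_nexts hopt.1 s).2 hs, rfl⟩⟩
  · exact h.optCost_le

theorem Inv.addChild {W : SPath S} (h : K.Inv I d (W :: L)) (hW : I.IsPath d W)
    (hWf : W.first = I.root d) : (K.addChild I d W).Inv I d L := by
  have hC : I.optCost ≤ (K.updateC I d W).C := by
    -- Each candidate for `C` is the cost of a solution, namely `W` joined to the reverse of `Y`.
    refine le_min h.optCost_le (le_iInf₂ ?_)
    rintro Y ⟨hY, hYl⟩
    have := h.isPath _ Y (Or.inl hY)
    exact ProblemInstance.optCost_le hW this.1 hWf this.2 hYl.symm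
  unfold NBSConfig.addChild
  split_ifs with hD
  · refine ⟨h.isPath, h.unique, h.disjoint, h.mem_trace, h.of_mem_trace, h.root,
      fun e X hX s hs => ?_, hC⟩
    rcases h.step e X hX s hs with ⟨rfl, hm⟩ | hr
    · rcases List.mem_cons.1 hm with rfl | hm
      · exact Or.inr hD
      · exact Or.inl ⟨rfl, hm⟩
    · exact Or.inr hr
  · have hlt : ∀ X, (X ∈ K.opn d ∨ X ∈ K.closed d) → X.last = W.last → I.c d W ≤ I.c d X :=
      fun X hX hl => le_of_not_ge fun hc => hD ⟨X, hX, hl, hc⟩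
    set K' := insertPath d (updateC I d K W) W with hK'
    have hmem : ∀ e X, (X ∈ K'.opn e ∨ X ∈ K'.closed e) ↔
        ((X ∈ K.opn e ∨ X ∈ K.closed e) ∧ ¬ (e = d ∧ X.last = W.last)) ∨ (e = d ∧ X = W) := by
      intro e X
      simp only [hK', insertPath, updateC, Set.mem_ofPred_eq]
      tauto
    have hmono : ∀ e X, (X ∈ K.opn e ∨ X ∈ K.closed e) →
        ∃ Y, (Y ∈ K'.opn e ∨ Y ∈ K'.closed e) ∧ Y.last = X.last ∧ I.c e Y ≤ I.c e X := by
      intro e X hX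
      by_cases hc : e = d ∧ X.last = W.last
      · obtain ⟨rfl, hl⟩ := hc
        exact ⟨W, (hmem _ _).2 (Or.inr ⟨rfl, rfl⟩), hl.symm, hlt X hX hl⟩
      · exact ⟨X, (hmem _ _).2 (Or.inl ⟨hX, hc⟩), rfl, le_rfl⟩
    constructor
    · intro e X hX
      rcases (hmem e X).1 hX with hX | ⟨rfl, rfl⟩
      exacts [h.isPath e X hX.1, ⟨hW, hWf⟩]
    · intro e X Y hX hY hl
      rcases (hmem e X).1 hX with hX | ⟨rfl, rfl⟩ <;>
        rcases (hmem e Y).1 hY with hY | ⟨h1, rfl⟩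
      · exact h.unique e X Y hX.1 hY.1 hl
      · exact (hX.2 ⟨h1, hl⟩).elim
      · exact (hY.2 ⟨rfl, hl.symm⟩).elim
      · rfl
    · rintro e X (h1 | ⟨rfl, rfl⟩) h2
      · exact h.disjoint e X h1.1 h2.1
      · exact h2.2 ⟨rfl, rfl⟩
    · exact fun e X hX => h.mem_trace e X hX.1
    · intro e X hX
      obtain ⟨h1, h2⟩ := h.of_mem_trace e X hX
      refine ⟨⟨h1, ?_⟩, h2⟩
      rintro ⟨rfl, hl⟩
      -- An expanded path is optimal, so it would dominate `W`; hence insertions never remove it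
      -- from the closed list.
      exact hD ⟨X, Or.inr h1, hl,
        h2.2 W hW (hWf.trans (h.isPath _ X (Or.inr h1)).2.symm) hl.symm⟩
    · intro e
      obtain ⟨X, h1, h2, h3⟩ := h.root e
      obtain ⟨Y, h4, h5, h6⟩ := hmono e X h1
      exact ⟨Y, h4, h5.trans h2, h6.trans h3⟩
    · intro e X hX s hs
      rcases h.step e X hX.1 s hs with ⟨rfl, hm⟩ | ⟨Z, h1, h2, h3⟩
      · rcases List.mem_cons.1 hm with rfl | hm
        · exact Or.inr ⟨X.snoc s, (hmem _ _).2 (Or.inr ⟨rfl, rfl⟩), rfl, le_rfl⟩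
        · exact Or.inl ⟨rfl, hm⟩
      · obtain ⟨Y, h4, h5, h6⟩ := hmono e Z h1
        exact Or.inr ⟨Y, h4, h5.trans h2, h6.trans h3⟩
    · exact hC

theorem Inv.foldl_addChild (h : K.Inv I d L)
    (hL : ∀ W ∈ L, I.IsPath d W ∧ W.first = I.root d) :
    (L.foldl (NBSConfig.addChild I d) K).Inv I d [] := by
  induction L generalizing K with
  | nil => exact h
  | cons W L ih =>
    have hW := hL W (by simp)
    exact ih (h.addChild hW.1 hW.2) fun X hX => hL X (by simp [hX])

theorem Inv.expandPath {U : SPath S} (h : K.Inv I d []) (hU : U ∈ K.opn d)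
    (hopt : I.IsOptimal d U) : (K.expandPath I d U).Inv I d [] := by
  refine (h.close hU hopt).foldl_addChild fun W hW => ?_
  obtain ⟨s, hs, rfl⟩ := List.mem_map.1 hW
  exact ⟨⟨hopt.1, (mem_nexts hopt.1 s).1 hs⟩, (h.isPath d U (Or.inl hU)).2⟩

theorem trace_addChild (W : SPath S) : (K.addChild I d W).trace = K.trace := by
  unfold addChild
  split_ifs <;> rfl

theorem opn_other_addChild (W : SPath S) :
    (K.addChild I d W).opn d.other = K.opn d.other := by
  unfold addChild
  split_ifs
  · rfl
  · ext X
    simp [insertPath, updateC, d.other_ne]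

theorem trace_expandPath (U : SPath S) :
    (K.expandPath I d U).trace = K.trace ++ [(d, U)] := by
  have : ∀ (L : List (SPath S)) (K : NBSConfig S),
      (L.foldl (addChild I d) K).trace = K.trace := by
    intro L
    induction L with
    | nil => exact fun K => rfl
    | cons W L ih => exact fun K => (ih _).trans (trace_addChild W)
  exact this _ _

theorem opn_other_expandPath (U : SPath S) :
    (K.expandPath I d U).opn d.other = K.opn d.other := by
  have : ∀ (L : List (SPath S)) (K : NBSConfig S),
      (L.foldl (addChild I d) K).opn d.other = K.opn d.other := by
    intro L
    induction L with
    | nil => exact fun K => rfl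
    | cons W L ih => exact fun K => (ih _).trans (opn_other_addChild W)
  refine (this _ _).trans ?_
  ext X
  simp [close, d.other_ne]

/-- Along every path from the root there is an open path that is at least as promising, unless a
path to the last state that is at least as cheap has been closed. -/
theorem Inv.exists_open (h : K.Inv I d []) (hI : I.IsCON) {U : SPath S} (hU : I.IsPath d U)
    (hUf : U.first = I.root d) :
    (∃ X ∈ K.opn d, I.c d X ≤ I.c d U ∧ I.f d X ≤ I.f d U) ∨
      ∃ X ∈ K.closed d, X.last = U.last ∧ I.c d X ≤ I.c d U := by
  have key : ∀ U : SPath S, ∀ X, (X ∈ K.opn d ∨ X ∈ K.closed d) → X.last = U.last →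
      I.c d X ≤ I.c d U → (∃ X ∈ K.opn d, I.c d X ≤ I.c d U ∧ I.f d X ≤ I.f d U) ∨
      ∃ X ∈ K.closed d, X.last = U.last ∧ I.c d X ≤ I.c d U := by
    rintro U X (hX | hX) hl hc
    · refine Or.inl ⟨X, hX, hc, ?_⟩
      rw [f, f, hl]
      exact add_le_add (by exact_mod_cast hc) le_rfl
    · exact Or.inr ⟨X, hX, hl, hc⟩
  induction U with
  | single s =>
    obtain ⟨X, h1, h2, h3⟩ := h.root d
    exact key _ X h1 (h2.trans hUf.symm) h3
  | snoc U s ih =>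
    rcases ih hU.1 hUf with ⟨X, h1, h2, h3⟩ | ⟨X, h1, h2, h3⟩
    -- An open path good enough for a prefix stays good enough: neither `c` nor, by consistency, `f`
    -- decreases when the path is extended.
    · refine Or.inl ⟨X, h1, h2.trans ?_, h3.trans (hI.f_le_f_snoc hU.2)⟩
      rw [c_snoc]
      exact le_self_add
    · obtain ⟨Y, h4, h5, h6⟩ := (h.step d X h1 s (h2 ▸ hU.2)).resolve_left (by simp)
      refine key _ Y h4 h5 (h6.trans ?_)
      rw [c_snoc, c_snoc, h2]
      exact add_le_add h3 le_rfl

theorem lb_mono {X Y U V : SPath S} (h1 : I.c .fwd X ≤ I.c .fwd U) (h2 : I.f .fwd X ≤ I.f .fwd U)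
    (h3 : I.c .bwd Y ≤ I.c .bwd V) (h4 : I.f .bwd Y ≤ I.f .bwd V) : I.lb X Y ≤ I.lb U V :=
  max_le_max (max_le_max h2 h4)
    (add_le_add (ENNReal.coe_le_coe.2 h1) (ENNReal.coe_le_coe.2 h3))

theorem lbmin_le {X Y : SPath S} (hX : X ∈ K.opn .fwd) (hY : Y ∈ K.opn .bwd) :
    K.lbmin I ≤ I.lb X Y :=
  (iInf₂_le X hX).trans (iInf₂_le Y hY)

theorem Inv.exists_open_pair (h : K.Inv I d []) (hI : I.IsCON) (hcov : ¬ Covers I K.trace) :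
    ∃ X ∈ K.opn .fwd, ∃ Y ∈ K.opn .bwd, I.lb X Y < I.optCost := by
  simp only [Covers, not_forall, not_or] at hcov
  obtain ⟨a, b, ⟨U, V, hU, hUf, hUl, hV, hVf, hVl, hlb⟩, ha, hb⟩ := hcov
  have h' := h.change_dir
  rcases (h' .fwd).exists_open hI hU.1 hUf with ⟨X, h1, h2, h3⟩ | ⟨X, h1, h2, h3⟩
  · rcases (h' .bwd).exists_open hI hV.1 hVf with ⟨Y, h4, h5, h6⟩ | ⟨Y, h4, h5, h6⟩
    · exact ⟨X, h1, Y, h4, (lb_mono h2 h3 h5 h6).trans_lt hlb⟩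
    · exact (hb ⟨Y, h.mem_trace _ _ h4, h5.trans hVl⟩).elim
  · exact (ha ⟨X, h.mem_trace _ _ h1, h2.trans hUl⟩).elim

/-- An open path which is cheapest among the open paths at least as promising is optimal. -/
theorem Inv.isOptimal (h : K.Inv I d []) (hI : I.IsCON) {U : SPath S} (hU : U ∈ K.opn d)
    (hmin : ∀ X ∈ K.opn d, I.c d X ≤ I.c d U → I.f d X ≤ I.f d U → I.c d U ≤ I.c d X) :
    I.IsOptimal d U := by
  have hP := h.isPath d U (Or.inl hU)
  refine ⟨hP.1, fun W hW hf hl => le_of_not_gt fun hlt => ?_⟩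
  rcases h.exists_open hI hW (hf.trans hP.2) with ⟨X, h1, h2, h3⟩ | ⟨X, h1, h2, h3⟩
  · refine ((hmin X h1 (h2.trans hlt.le) (h3.trans ?_)).trans h2).not_gt hlt
    rw [f, f, hl]
    exact add_le_add (by exact_mod_cast hlt.le) le_rfl
  · obtain rfl := h.unique d X U (Or.inr h1) (Or.inl hU) (h2.trans hl)
    exact h3.not_gt hlt

/-- An expanded path to the same state would still be closed, and the lists hold only one path per
state. -/
theorem Inv.last_notMem_expandedStates (h : K.Inv I d []) {U : SPath S} (hU : U ∈ K.opn e) :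
    U.last ∉ expandedStates K.trace e := by
  rintro ⟨X, hX, hl⟩
  have hc := (h.of_mem_trace e X hX).1
  obtain rfl := h.unique e X U (Or.inr hc) (Or.inl hU) hl
  exact h.disjoint e X hU hc

theorem Inv.not_halted (h : K.Inv I d []) (hI : I.IsCON) (hcov : ¬ Covers I K.trace) :
    ¬ K.Halted I := by
  obtain ⟨X, hX, Y, hY, hlt⟩ := h.exists_open_pair hI hcov
  rintro (h1 | h1 | h1)
  · rw [h1] at hX; exact hX
  · rw [h1] at hY; exact hY
  · exact (h.optCost_le.trans (h1.trans (lbmin_le hX hY))).not_gt hlt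

/-- As long as some surely expanded pair is not covered, an iteration expands a surely expanded pair
of states, both for the first time. -/
theorem Inv.iterate {K' : NBSConfig S} (h : K.Inv I d []) (hI : I.IsCON)
    (hcov : ¬ Covers I K.trace) (hit : K.Iterate I K') :
    K'.Inv I d [] ∧ ∃ U V, K'.trace = K.trace ++ [(.fwd, U), (.bwd, V)] ∧
      I.SurelyExpanded U.last V.last ∧ U.last ∉ expandedStates K.trace .fwd ∧
      V.last ∉ expandedStates K.trace .bwd := by
  obtain ⟨X, hX, Y, hY, hlt⟩ := h.exists_open_pair hI hcov
  obtain ⟨-, U, V, ⟨⟨V₀, hUo, hV₀o, hV₀⟩, hUmin⟩, ⟨⟨-, hVo, hlb⟩, hVmin⟩, rfl⟩ := hit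
  simp only at hUo hV₀o hV₀ hVo hlb
  -- A rival `Z` no worse than `U` in `c` and `f` also attains `lbmin` together with `V`, so it
  -- belongs to `Uset` and the tie-breaking by cost applies to it.
  have hUopt : I.IsOptimal .fwd U := (h.change_dir _).isOptimal hI hUo fun Z hZ hc hf =>
    hUmin Z ⟨V, hZ, hVo, le_antisymm ((lb_mono hc hf le_rfl le_rfl).trans hlb.le)
      (lbmin_le hZ hVo)⟩
  have hVopt : I.IsOptimal .bwd V := (h.change_dir _).isOptimal hI hVo fun Z hZ hc hf =>
    hVmin Z ⟨hUo, hZ, le_antisymm ((lb_mono le_rfl le_rfl hc hf).trans hlb.le) (lbmin_le hUo hZ)⟩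
  have h1 := (h.change_dir .fwd).expandPath hUo hUopt
  -- `V` was selected before `U` was expanded; forward expansion leaves the backward open list
  -- alone.
  have hVo' : V ∈ (K.expandPath I .fwd U).opn .bwd := by
    have := opn_other_expandPath (I := I) (K := K) (d := .fwd) U
    simp only [Dir.other] at this
    rwa [this]
  refine ⟨((h1.change_dir .bwd).expandPath hVo' hVopt).change_dir d, U, V, ?_, ?_,
    h.last_notMem_expandedStates hUo, h.last_notMem_expandedStates hVo⟩
  · rw [trace_expandPath, trace_expandPath]
    simp
  · exact ⟨U, V, hUopt, (h.isPath _ U (Or.inl hUo)).2, rfl, hVopt,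
      (h.isPath _ V (Or.inl hVo)).2, rfl, by rw [hlb]; exact (lbmin_le hX hY).trans_lt hlt⟩

end NBSConfig

/-! ### Matchings against covers. -/

theorem expandedStates_finite (T : Trace S) (d : Dir) : (expandedStates T d).Finite := by
  refine ((List.finite_toSet T).image fun p => p.2.last).subset ?_
  rintro s ⟨U, hU, rfl⟩
  exact ⟨(d, U), hU, rfl⟩

theorem expandedStates_mono {T T' : Trace S} (h : T ⊆ T') (d : Dir) :
    expandedStates T d ⊆ expandedStates T' d := by
  rintro s ⟨U, hU, rfl⟩
  exact ⟨U, h hU, rfl⟩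

/-- A matching of surely expanded pairs is at most as large as a cover. -/
theorem Covers.card_le_numExpandedStates {T : Trace S} (hT : Covers I T) {M : Finset (S × S)}
    (hM : ∀ p ∈ M, I.SurelyExpanded p.1 p.2) (h1 : Set.InjOn Prod.fst (M : Set (S × S)))
    (h2 : Set.InjOn Prod.snd (M : Set (S × S))) : M.card ≤ numExpandedStates T := by
  classical
  -- Each pair is charged to its first state if that is expanded forward, and otherwise to its
  -- second, which is then expanded backward.
  rw [← M.card_filter_add_card_filter_not (fun p => p.1 ∈ expandedStates T .fwd)]
  refine add_le_add ?_ ?_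
  · rw [← Set.ncard_coe_finset]
    refine Set.ncard_le_ncard_of_injOn Prod.fst ?_ (h1.mono ?_) (expandedStates_finite _ _)
    · intro p hp
      simp only [Finset.coe_filter, Set.mem_ofPred_eq] at hp
      exact hp.2
    · exact fun p hp => (Finset.mem_filter.1 hp).1
  · rw [← Set.ncard_coe_finset]
    refine Set.ncard_le_ncard_of_injOn Prod.snd ?_ (h2.mono ?_) (expandedStates_finite _ _)
    · intro p hp
      simp only [Finset.coe_filter, Set.mem_ofPred_eq] at hp
      exact (hT _ _ (hM p hp.1)).resolve_left hp.2
    · exact fun p hp => (Finset.mem_filter.1 hp).1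

/-- Before the surely expanded pairs are covered, the iterations of NBS make up a matching. -/
theorem IsNBSRun.exists_matching (hI : I.IsCON) {K : ℕ → NBSConfig S} (hK : IsNBSRun I K) (n : ℕ)
    (hn : ∀ i < n, ¬ Covers I (K i).trace) :
    (K n).Inv I .fwd [] ∧ (K n).trace.length = 2 * n ∧ ∃ M : Finset (S × S), M.card = n ∧
      (∀ p ∈ M, I.SurelyExpanded p.1 p.2 ∧ p.1 ∈ expandedStates (K n).trace .fwd ∧
        p.2 ∈ expandedStates (K n).trace .bwd) ∧
      Set.InjOn Prod.fst (M : Set (S × S)) ∧ Set.InjOn Prod.snd (M : Set (S × S)) := by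
  classical
  induction n with
  | zero =>
    rw [hK.1]
    exact ⟨NBSConfig.inv_init, rfl, ∅, by simp⟩
  | succ n ih =>
    obtain ⟨hinv, hlen, M, hM, hMem, hM1, hM2⟩ := ih fun i hi => hn i (by omega)
    have hcov := hn n (by omega)
    have hit := (hK.2 n).resolve_right fun h => hinv.not_halted hI hcov h.1
    obtain ⟨hinv', U, V, htr, hse, hU, hV⟩ := hinv.iterate hI hcov hit
    have hsub : (K n).trace ⊆ (K (n + 1)).trace := by
      rw [htr]; exact List.subset_append_left _ _
    have hnot : ∀ p ∈ M, p.1 ≠ U.last ∧ p.2 ≠ V.last := fun p hp =>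
      ⟨fun h => hU (h ▸ (hMem p hp).2.1), fun h => hV (h ▸ (hMem p hp).2.2)⟩
    have hnew : (U.last, V.last) ∉ M := fun h => (hnot _ h).1 rfl
    refine ⟨hinv', by simp [htr, hlen]; ring, insert (U.last, V.last) M, ?_, ?_, ?_, ?_⟩
    · rw [Finset.card_insert_of_notMem hnew, hM]
    · intro p hp
      rcases Finset.mem_insert.1 hp with rfl | hp
      · refine ⟨hse, ⟨U, ?_, rfl⟩, ⟨V, ?_, rfl⟩⟩ <;> simp [htr]
      · obtain ⟨h1, h2, h3⟩ := hMem p hp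
        exact ⟨h1, expandedStates_mono hsub _ h2, expandedStates_mono hsub _ h3⟩
    · rw [Finset.coe_insert, Set.injOn_insert (by simpa using hnew)]
      refine ⟨hM1, ?_⟩
      rintro ⟨p, hp, h⟩
      exact (hnot p hp).1 h
    · rw [Finset.coe_insert, Set.injOn_insert (by simpa using hnew)]
      refine ⟨hM2, ?_⟩
      rintro ⟨p, hp, h⟩
      exact (hnot p hp).2 h

theorem nbsCoverCount_le (hI : I.IsCON) {K : ℕ → NBSConfig S} (hK : IsNBSRun I K) {T : Trace S}
    (hT : Covers I T) : nbsCoverCount I K ≤ 2 * (numExpandedStates T : ℕ∞) := by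
  classical
  have bound : ∀ n, (∀ i < n, ¬ Covers I (K i).trace) → n ≤ numExpandedStates T := by
    intro n hn
    obtain ⟨-, -, M, hM, hMem, h1, h2⟩ := hK.exists_matching hI n hn
    rw [← hM]
    exact hT.card_le_numExpandedStates (fun p hp => (hMem p hp).1) h1 h2
  -- If NBS never covered, its matching would outgrow the finite cover `T`.
  have hex : ∃ n, Covers I (K n).trace := by
    by_contra hno
    have := bound (numExpandedStates T + 1) fun i _ h => hno ⟨i, h⟩
    omega
  have hmin : ∀ i < Nat.find hex, ¬ Covers I (K i).trace := fun i hi => Nat.find_min hex hi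
  refine (iInf₂_le (Nat.find hex) (Nat.find_spec hex)).trans ?_
  rw [(hK.exists_matching hI _ hmin).2.1]
  exact_mod_cast Nat.mul_le_mul_left 2 (bound _ hmin)

end BiSearch

open BiSearch
theorem corollary1 {S : Type*} [Infinite S] :
    (∀ (I : ProblemInstance S), I.IsCON →
      ∀ (K : ℕ → NBSConfig S), IsNBSRun I K →
      ∀ (A : DXBB S), A.Admissible →
        A.coverCount I ≠ ⊤ ∧ nbsCoverCount I K ≠ ⊤ ∧
          nbsCoverCount I K ≤ 2 * A.coverCount I) ∧
    nbsWorstCaseRatio S ≤ 2 := by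
  have main : ∀ (I : ProblemInstance S), I.IsCON → ∀ (K : ℕ → NBSConfig S), IsNBSRun I K →
      ∀ A : DXBB S, nbsCoverCount I K ≤ 2 * A.coverCount I := fun I hI K hK A => by
    -- Moving the factor inside the infimum leaves one inequality per covering prefix of the run; if
    -- there is none, the right side is `⊤`.
    simp only [DXBB.coverCount, ENat.mul_iInf_of_ne (by simp : (2 : ℕ∞) ≠ 0)]
    exact le_iInf₂ fun n hn => nbsCoverCount_le hI hK hn
  refine ⟨fun I hI K hK A hA => ?_, ?_⟩
  · obtain ⟨n, hn⟩ := hA.exists_covers hI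
    exact ⟨ne_top_of_le_ne_top (ENat.natCast_ne_top _) (iInf₂_le n hn),
      ne_top_of_le_ne_top (by exact_mod_cast ENat.natCast_ne_top _) (nbsCoverCount_le hI hK hn),
      main I hI K hK A⟩
  -- The multiplied form also settles a zero denominator, since it forces the numerator to vanish.
  · refine iSup₂_le fun I hI => iSup₂_le fun K hK => ENNReal.div_le_of_le_mul ?_
    have : nbsCoverCount I K ≤ 2 * minCoverCount I := by
      simp only [minCoverCount, ENat.mul_iInf_of_ne (by simp : (2 : ℕ∞) ≠ 0)]
      exact le_iInf fun A => main I hI K hK A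
    exact_mod_cast ENat.toENNReal_le.2 this
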